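/- Let $p,s,\gamma,c_-,c_+,r_0,r_1,K_0>0$, $D\ge 0$ and $0<\kappa<c_-r_0^s/8$ be real numbers. Then there exist constants $0<c\le C<\infty$ and an integer $n_0$, depending only on these numbers, such that the following holds. Let $d\ge 1$, let $(\Omega,\mathcal F,\mathrm P)$ be a probability space, and let $[X_{n,i}]_{1\le i\le n,\ n\ge 1}$ be a triangular array of $\mathbb R^d$-valued random variables on it which all have the same law $\mu$. For $m\ge 1$ let $$\alpha_m:=\sup_{n\ge 1}\ \sup_{1\le j\le n-m}\ \sup\big\{|\mathrm P(A\cap B)-\mathrm P(A)\mathrm P(B)| : A\in\sigma(X_{n,1},\dots,X_{n,j}),\ B\in\sigma(X_{n,j+m},\dots,X_{n,n})\big\}.$$ Let $x\in\mathbb R^d$, let $B(x,r)$ be the closed Euclidean ball of radius $r$ around $x$, and let $R_{n,k}(x)$ be the Euclidean distance from $x$ to its $k$th nearest neighbor among $X_{n,1},\dots,X_{n,n}$ ($1\le k\le n$; ties broken arbitrarily). Assume that 1. (geometric $\alpha$-mixing) $\alpha_m\le e^{-\gamma m}$ for all $m\ge 1$; 2. (local lower mass of order $s$) $\mu(B(x,r))\ge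 c_-r^s$ for all $0<r\le r_0$; 3. (local upper mass of the same order $s$) $\mu(B(x,r))\le c_+r^s$ for all $0<r\le r_1$; 4. (compact support) the support of $\mu$ is contained in a compact set of diameter at most $D$. Then for all $n\ge n_0$ and all integers $k$ with $K_0\log n\le k\le\kappa n$, the variable $R_{n,k}(x)^p$ is integrable and $$c\Big(\frac kn\Big)^{p/s}\le \mathrm E\big[R_{n,k}(x)^p\big]\le C\Big(\frac kn\Big)^{p/s}.$$ -/

import Mathlib

open MeasureTheory

noncomputable section

namespace KNN

/-- A triangular array: the `n`th row consists of the `n` random variables `X n i`, `i : Fin n`.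
The entry written `X_{n,i}` with `1 ≤ i ≤ n` in the usual 1-based numbering is `X n ⟨i - 1, _⟩`. -/
abbrev TriangularArray (Ω : Type*) (E : Type*) := (n : ℕ) → Fin n → Ω → E

variable {Ω : Type*} {E : Type*}

/-- The σ-field generated by the segment `X_{n,a}, …, X_{n,b}` (1-based) of the `n`th row. -/
abbrev segmentSigma [MeasurableSpace E] (X : TriangularArray Ω E) (n a b : ℕ) : MeasurableSpace Ω :=
  ⨆ (i : Fin n) (_ : a ≤ i.val + 1 ∧ i.val + 1 ≤ b),
    MeasurableSpace.comap (X n i) inferInstance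

/-- The values `|P(A ∩ B) - P(A) P(B)|` over all rows `n`, all cut points `1 ≤ j ≤ n - m`, and all
events `A` of the segment `1, …, j` and `B` of the segment `j + m, …, n`. -/
def mixingSet [MeasurableSpace Ω] [MeasurableSpace E] (P : Measure Ω)
    (X : TriangularArray Ω E) (m : ℕ) : Set ℝ :=
  {a | ∃ (n j : ℕ) (A B : Set Ω), 1 ≤ j ∧ j + m ≤ n ∧
    MeasurableSet[segmentSigma X n 1 j] A ∧ MeasurableSet[segmentSigma X n (j + m) n] B ∧
    a = |P.real (A ∩ B) - P.real A * P.real B|}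

/-- The strong mixing coefficient `α_m` of the array. -/
def alphaCoeff [MeasurableSpace Ω] [MeasurableSpace E] (P : Measure Ω)
    (X : TriangularArray Ω E) (m : ℕ) : ℝ :=
  sSup (mixingSet P X m)

/-- The supremum defining `α_m` is over a nonempty set. -/
theorem mixingSet_nonempty [MeasurableSpace Ω] [MeasurableSpace E] (P : Measure Ω)
    (X : TriangularArray Ω E) (m : ℕ) : (mixingSet P X m).Nonempty :=
  ⟨_, 1 + m, 1, ∅, ∅, le_rfl, le_rfl, @MeasurableSet.empty _ (_), @MeasurableSet.empty _ (_), rfl⟩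

/-- The supremum defining `α_m` is over a bounded set. -/
theorem mixingSet_bddAbove [MeasurableSpace Ω] [MeasurableSpace E] (P : Measure Ω)
    [IsProbabilityMeasure P] (X : TriangularArray Ω E) (m : ℕ) : BddAbove (mixingSet P X m) := by
  refine ⟨1, ?_⟩
  rintro a ⟨n, j, A, B, -, -, -, -, rfl⟩
  have h1 : P.real (A ∩ B) ≤ 1 := measureReal_le_one
  have h2 : P.real A * P.real B ≤ 1 :=
    mul_le_one₀ measureReal_le_one measureReal_nonneg measureReal_le_one
  have h3 : 0 ≤ P.real (A ∩ B) := measureReal_nonneg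
  have h4 : 0 ≤ P.real A * P.real B := mul_nonneg measureReal_nonneg measureReal_nonneg
  rw [abs_le]
  constructor <;> linarith

/-- Geometric `α`-mixing with rate `γ`. -/
def GeometricMixing [MeasurableSpace Ω] [MeasurableSpace E] (P : Measure Ω)
    (X : TriangularArray Ω E) (γ : ℝ) : Prop :=
  ∀ m : ℕ, 1 ≤ m → alphaCoeff P X m ≤ Real.exp (-γ * m)

/-- The entries of the array are random variables, all with law `μ`. -/
def HasMarginal [MeasurableSpace Ω] [MeasurableSpace E] (P : Measure Ω)
    (X : TriangularArray Ω E) (μ : Measure E) : Prop :=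
  ∀ (n : ℕ) (i : Fin n), Measurable (X n i) ∧ P.map (X n i) = μ

/-- `μ(B(x,r)) ≥ c r^s` for all `0 < r ≤ r₀`, with closed balls. -/
def LocalLowerMass [PseudoMetricSpace E] [MeasurableSpace E] (μ : Measure E) (x : E)
    (c r₀ s : ℝ) : Prop :=
  ∀ r : ℝ, 0 < r → r ≤ r₀ → c * r ^ s ≤ μ.real (Metric.closedBall x r)

/-- `μ(B(x,r)) ≤ c r^s` for all `0 < r ≤ r₀`, with closed balls. -/
def LocalUpperMass [PseudoMetricSpace E] [MeasurableSpace E] (μ : Measure E) (x : E)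
    (c r₀ s : ℝ) : Prop :=
  ∀ r : ℝ, 0 < r → r ≤ r₀ → μ.real (Metric.closedBall x r) ≤ c * r ^ s

/-- The support of `μ` lies in a compact set of diameter at most `D`. -/
def SupportInCompact [PseudoMetricSpace E] [MeasurableSpace E] (μ : Measure E) (D : ℝ) : Prop :=
  ∃ K : Set E, IsCompact K ∧ Metric.diam K ≤ D ∧ μ.support ⊆ K

/-- A permutation listing the points of the `n`th row by nondecreasing distance from `x`
(ties are broken by the index; see `nnRadius_eq_of_monotone`). -/
def nnPerm [SeminormedAddCommGroup E] (X : TriangularArray Ω E) (x : E) (n : ℕ) (ω : Ω) :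
    Equiv.Perm (Fin n) :=
  Tuple.sort fun i => ‖X n i ω - x‖

/-- The `k`th nearest neighbor of `x` among the points of the `n`th row, for `1 ≤ k ≤ n`
(with the value `x` for other `k`). -/
def nearestNeighbor [SeminormedAddCommGroup E] (X : TriangularArray Ω E) (x : E) (n k : ℕ)
    (ω : Ω) : E :=
  if h : 1 ≤ k ∧ k ≤ n then X n (nnPerm X x n ω ⟨k - 1, by omega⟩) ω else x

/-- The `k`-nearest-neighbor radius `R_{n,k}(x)`. -/
def nnRadius [SeminormedAddCommGroup E] (X : TriangularArray Ω E) (x : E) (n k : ℕ)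
    (ω : Ω) : ℝ :=
  ‖nearestNeighbor X x n k ω - x‖

/-- The radius does not depend on how ties are broken. -/
theorem nnRadius_eq_of_monotone [SeminormedAddCommGroup E] (X : TriangularArray Ω E) (x : E)
    (n k : ℕ) (ω : Ω) (h : 1 ≤ k ∧ k ≤ n) (τ : Equiv.Perm (Fin n))
    (hτ : Monotone fun i => ‖X n (τ i) ω - x‖) :
    nnRadius X x n k ω = ‖X n (τ ⟨k - 1, by omega⟩) ω - x‖ := by
  have h1 := (Tuple.comp_sort_eq_comp_iff_monotone (f := fun i => ‖X n i ω - x‖)).2 hτ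
  have h2 := congrFun h1 ⟨k - 1, by omega⟩
  simp only [nnRadius, nearestNeighbor, h, and_self, dif_pos]
  first | exact h2 | exact h2.symm

end KNN

end

/-!
The `k`th neighbor radius exceeds `t` exactly when the number `N(t)` of points of the row in
`B(x, t)` is less than `k` (`KNN.lt_nnRadius_iff`), so both bounds are statements about `N(t)`, a
sum of `n` indicators with mean `n μ(B(x, t))`. Write `u = k / n`; the claim is that the radius
lives at the scale `u ^ (1 / s)`.

*Lower bound.* For `t = ε u ^ (1 / s)` with `ε` small the mean of `N(t)` is at most `k / 2`, so by
Markov's inequality the radius exceeds `t` with probability at least `1 / 2`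
(`KNN.le_integral_nnRadius_rpow`).

*Upper bound.* By the exponential Chebyshev inequality, a lower tail of `N(t)` follows from a bound
on `E exp (-θ N(t))`. Split the indices into residue classes modulo `m`. By convexity of `exp` it
suffices to treat the points of one class, whose indices are at distance at least `m`; there the
expectation of a product of functions `1 - c 1_B(X_i)` factorizes up to an error `exp (-γ m)` per
factor (`KNN.integral_prod_progression_le`). With `m` a large multiple of `log n` the total error
is `O(n ^ (-b))`, for any prescribed `b`. Since `k ≥ K₀ log n`, also `m = O(k)`, so `θ`
may be taken of order `1 / k`, and the probability that the radius exceeds `t` is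
at most a constant times `exp (-const * t ^ s / u) + n ^ (-b)`, hence of order `(u / t ^ s) ^ b`
for all `t ≤ r₀` (`KNN.measureReal_lt_nnRadius_le`). No lower bound on `K₀` or `γ` is needed: small
values only worsen the constant in the exponent, which a large multiple of the scale
`u ^ (1 / s)` compensates. The choice `b = 2 p / s` gives a tail that is integrable
against `t ^ (p - 1)`, and the boundedness of the support takes care of `t > r₀`
(`KNN.integral_nnRadius_rpow_le`).
-/

/-! ### The counting variable -/

namespace KNN

variable {Ω E : Type*}

/-- The number of points of the `n`th row in the closed ball of radius `t` around `x`. -/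
noncomputable def ballCount [SeminormedAddCommGroup E] (X : TriangularArray Ω E) (x : E) (n : ℕ)
    (t : ℝ) (ω : Ω) : ℕ :=
  (Finset.univ.filter fun i : Fin n => ‖X n i ω - x‖ ≤ t).card

/-- The event that the `i`th point of the `n`th row (0-based) lies in the closed ball of radius
`t` around `x`; it is empty for `n ≤ i`. Indexing by `ℕ` rather than `Fin n` makes the sums over
arithmetic progressions of indices below free of bound proofs. -/
def ballEvent [SeminormedAddCommGroup E] (X : TriangularArray Ω E) (x : E) (n : ℕ) (t : ℝ)
    (i : ℕ) : Set Ω :=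
  {ω | ∃ h : i < n, ‖X n ⟨i, h⟩ ω - x‖ ≤ t}

theorem segmentSigma_le [MeasurableSpace Ω] [MeasurableSpace E] {P : Measure Ω}
    {μ : Measure E} {X : TriangularArray Ω E} {n : ℕ} (hX : HasMarginal P X μ) (a b : ℕ) :
    segmentSigma X n a b ≤ ‹MeasurableSpace Ω› :=
  iSup₂_le fun i _ => (hX n i).1.comap_le

section Counting

variable [SeminormedAddCommGroup E] {X : TriangularArray Ω E} {x : E} {n k : ℕ} {t : ℝ}

theorem lt_nnRadius_iff (h : 1 ≤ k ∧ k ≤ n) (ω : Ω) :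
    t < nnRadius X x n k ω ↔ ballCount X x n t ω < k := by
  set f : Fin n → ℝ := fun i => ‖X n i ω - x‖ with hf
  have hmono : Monotone (f ∘ Tuple.sort f) := Tuple.monotone_sort f
  have h1 := Tuple.lt_card_le_iff_apply_le_of_monotone (n := n) (f := f ∘ Tuple.sort f) (a := t)
    (j := ⟨k - 1, by omega⟩) hmono
  have h2 : (Finset.univ.filter fun i => (f ∘ Tuple.sort f) i ≤ t).card = ballCount X x n t ω := by
    rw [ballCount, ← Fintype.card_subtype, ← Fintype.card_subtype]
    exact Fintype.card_congr ((Tuple.sort f).subtypeEquiv fun i => Iff.rfl)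
  have h3 : nnRadius X x n k ω = (f ∘ Tuple.sort f) ⟨k - 1, by omega⟩ := by
    simp only [nnRadius, nearestNeighbor, h, and_self, dif_pos]
    rfl
  rw [h2] at h1
  rw [h3, ← not_le, ← h1]
  simp only
  omega

theorem nnRadius_nonneg (ω : Ω) : 0 ≤ nnRadius X x n k ω := norm_nonneg _

theorem ballCount_eq_sum (ω : Ω) :
    (ballCount X x n t ω : ℝ) =
      ∑ i ∈ Finset.range n, (ballEvent X x n t i).indicator (fun _ => (1 : ℝ)) ω := by
  classical
  rw [ballCount, Finset.card_filter, Nat.cast_sum,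
    ← Fin.sum_univ_eq_sum_range (fun i => (ballEvent X x n t i).indicator (fun _ => (1 : ℝ)) ω)]
  refine Finset.sum_congr rfl fun i _ => ?_
  simp [Set.indicator, ballEvent]

theorem ballEvent_eq {i : ℕ} (hi : i < n) :
    ballEvent X x n t i = X n ⟨i, hi⟩ ⁻¹' Metric.closedBall x t := by
  ext ω
  simp [ballEvent, hi, dist_eq_norm]

/-- The events of the points with 0-based index at least `a - 1` and at most `b - 1` lie in the
σ-field of the corresponding segment. -/
theorem measurableSet_segmentSigma_ballEvent [MeasurableSpace E] [OpensMeasurableSpace E]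
    {i a b : ℕ} (hi : i < n) (ha : a ≤ i + 1) (hb : i + 1 ≤ b) :
    MeasurableSet[segmentSigma X n a b] (ballEvent X x n t i) := by
  have hle : MeasurableSpace.comap (X n ⟨i, hi⟩) inferInstance ≤ segmentSigma X n a b :=
    le_iSup₂_of_le (f := fun (i : Fin n) (_ : a ≤ i.val + 1 ∧ i.val + 1 ≤ b) =>
      MeasurableSpace.comap (X n i) inferInstance) ⟨i, hi⟩ ⟨ha, hb⟩ le_rfl
  rw [ballEvent_eq hi]
  exact hle _ ⟨_, Metric.isClosed_closedBall.measurableSet, rfl⟩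

variable [MeasurableSpace Ω] [MeasurableSpace E] {P : Measure Ω} {μ : Measure E}

variable [OpensMeasurableSpace E]

theorem measurableSet_ballEvent (hX : HasMarginal P X μ) (i : ℕ) :
    MeasurableSet (ballEvent X x n t i) := by
  by_cases hi : i < n
  · rw [ballEvent_eq hi]
    exact (hX n _).1 Metric.isClosed_closedBall.measurableSet
  · simp [ballEvent, hi]

theorem measureReal_ballEvent (hX : HasMarginal P X μ) {i : ℕ} (hi : i < n) :
    P.real (ballEvent X x n t i) = μ.real (Metric.closedBall x t) := by
  rw [ballEvent_eq hi, ← (hX n ⟨i, hi⟩).2,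
    map_measureReal_apply (hX n _).1 Metric.isClosed_closedBall.measurableSet]

theorem measurable_ballCount (hX : HasMarginal P X μ) :
    Measurable fun ω => (ballCount X x n t ω : ℝ) := by
  simp only [ballCount_eq_sum]
  exact Finset.measurable_fun_sum _ fun i _ =>
    measurable_const.indicator (measurableSet_ballEvent hX i)

theorem measurable_nnRadius (hX : HasMarginal P X μ) (h : 1 ≤ k ∧ k ≤ n) :
    Measurable (nnRadius X x n k) := by
  refine measurable_of_Ioi fun t => ?_
  have : nnRadius X x n k ⁻¹' Set.Ioi t = {ω | (ballCount X x n t ω : ℝ) < k} := by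
    ext ω
    simp [lt_nnRadius_iff h]
  rw [this]
  exact measurableSet_lt (measurable_ballCount hX) measurable_const

theorem integrable_ballCount [IsFiniteMeasure P] (hX : HasMarginal P X μ) :
    Integrable (fun ω => (ballCount X x n t ω : ℝ)) P := by
  simp only [ballCount_eq_sum]
  exact integrable_finsetSum _ fun i _ =>
    (integrable_const _).indicator (measurableSet_ballEvent hX i)

theorem integral_ballCount [IsFiniteMeasure P] (hX : HasMarginal P X μ) :
    ∫ ω, (ballCount X x n t ω : ℝ) ∂P = n * μ.real (Metric.closedBall x t) := by
  simp only [ballCount_eq_sum]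
  rw [integral_finsetSum _ fun i _ =>
    (integrable_const _).indicator (measurableSet_ballEvent hX i)]
  rw [Finset.sum_congr rfl fun i hi => ?_, Finset.sum_const, Finset.card_range, nsmul_eq_mul]
  rw [← measureReal_ballEvent hX (Finset.mem_range.1 hi)]
  exact integral_indicator_one (measurableSet_ballEvent hX i)

/-- Markov's inequality for the counting variable: if the ball of radius `t` holds at most `k / 2`
points on average, then the `k`th neighbor lies outside it with probability at least `1 / 2`. -/
theorem half_le_measureReal_lt_nnRadius [IsProbabilityMeasure P] (hX : HasMarginal P X μ)
    (h : 1 ≤ k ∧ k ≤ n) (hq : n * μ.real (Metric.closedBall x t) ≤ k / 2) :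
    1 / 2 ≤ P.real {ω | t < nnRadius X x n k ω} := by
  have hk : (0 : ℝ) < k := by exact_mod_cast h.1
  have hmarkov := mul_meas_ge_le_integral_of_nonneg (μ := P)
    (f := fun ω => (ballCount X x n t ω : ℝ)) (ae_of_all _ fun ω => Nat.cast_nonneg _)
    (integrable_ballCount hX) (k : ℝ)
  rw [integral_ballCount hX] at hmarkov
  have hcompl : {ω | t < nnRadius X x n k ω} = {ω | (k : ℝ) ≤ ballCount X x n t ω}ᶜ := by
    ext ω
    simp [lt_nnRadius_iff h]
  rw [hcompl, probReal_compl_eq_one_sub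
    (measurableSet_le measurable_const (measurable_ballCount hX))]
  have : P.real {ω | (k : ℝ) ≤ ballCount X x n t ω} ≤ 1 / 2 := by
    refine le_of_mul_le_mul_left ?_ hk
    linarith
  linarith

end Counting

end KNN

/-! ### The Laplace transform of the counting variable under mixing -/

namespace KNN

theorem one_sub_mul_indicator_mem_Icc {Ω : Type*} {c : ℝ} (hc : c ∈ Set.Icc (0 : ℝ) 1) (A : Set Ω)
    (ω : Ω) : 1 - c * A.indicator (fun _ => (1 : ℝ)) ω ∈ Set.Icc (0 : ℝ) 1 := by
  obtain ⟨h0, h1⟩ := hc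
  by_cases h : ω ∈ A <;> simp [h, h0, h1]

theorem integrable_prod_one_sub_indicator {Ω ι : Type*} [MeasurableSpace Ω] {P : Measure Ω}
    [IsFiniteMeasure P] {s : ι → Set Ω} {c : ℝ} (hc : c ∈ Set.Icc (0 : ℝ) 1)
    (hs : ∀ i, MeasurableSet (s i)) (T : Finset ι) :
    Integrable (fun ω => ∏ i ∈ T, (1 - c * (s i).indicator (fun _ => (1 : ℝ)) ω)) P := by
  refine Integrable.of_bound (Finset.measurable_fun_prod _ fun i _ => measurable_const.sub
    ((measurable_const.indicator (hs i)).const_mul c)).aestronglyMeasurable 1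
    (ae_of_all _ fun ω => ?_)
  rw [Real.norm_eq_abs, abs_of_nonneg (Finset.prod_nonneg fun i _ =>
    (one_sub_mul_indicator_mem_Icc hc (s i) ω).1)]
  exact Finset.prod_le_one (fun i _ => (one_sub_mul_indicator_mem_Icc hc (s i) ω).1)
    fun i _ => (one_sub_mul_indicator_mem_Icc hc (s i) ω).2

/-- A covariance inequality: a bound on the dependence between the events of a σ-field `m` and an
event `B` passes, with the same constant, to products of functions `1 - c 1_{s i}` with
`s i ∈ m`. Such a product is a convex combination of indicators of events of `m`, because
`1 - c 1_{s i} = (1 - c) + c 1_{(s i)ᶜ}`; the extra event `A` is what makes the induction on the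
number of factors go through. -/
theorem abs_setIntegral_prod_sub_le {Ω ι : Type*} {m : MeasurableSpace Ω} [mΩ : MeasurableSpace Ω]
    {P : Measure Ω} [IsFiniteMeasure P] (hm : m ≤ mΩ) {s : ι → Set Ω} {c : ℝ} {B : Set Ω} {α : ℝ}
    (hα : ∀ A, MeasurableSet[m] A → |P.real (A ∩ B) - P.real A * P.real B| ≤ α)
    (hc : c ∈ Set.Icc (0 : ℝ) 1) (hs' : ∀ i, MeasurableSet (s i)) (T : Finset ι)
    (hs : ∀ i ∈ T, MeasurableSet[m] (s i)) {A : Set Ω} (hA : MeasurableSet[m] A) :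
    |(∫ ω in A ∩ B, ∏ i ∈ T, (1 - c * (s i).indicator (fun _ => (1 : ℝ)) ω) ∂P) -
      (∫ ω in A, ∏ i ∈ T, (1 - c * (s i).indicator (fun _ => (1 : ℝ)) ω) ∂P) * P.real B| ≤ α := by
  classical
  induction T using Finset.induction_on generalizing A with
  | empty => simpa using hα A hA
  | insert i T hi ih =>
    have hint := integrable_prod_one_sub_indicator (P := P) hc hs' T
    have hsi : MeasurableSet[m] (s i) := hs i (Finset.mem_insert_self i T)
    -- peel off the factor of index `i` over an arbitrary region `S`
    have key : ∀ S : Set Ω,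
        ∫ ω in S, ∏ j ∈ insert i T, (1 - c * (s j).indicator (fun _ => (1 : ℝ)) ω) ∂P =
          (1 - c) * (∫ ω in S, ∏ j ∈ T, (1 - c * (s j).indicator (fun _ => (1 : ℝ)) ω) ∂P) +
          c * ∫ ω in S ∩ (s i)ᶜ, ∏ j ∈ T, (1 - c * (s j).indicator (fun _ => (1 : ℝ)) ω) ∂P := by
      intro S
      rw [← setIntegral_indicator (hm _ hsi).compl, ← integral_const_mul, ← integral_const_mul,
        ← integral_add (hint.integrableOn.const_mul _)
          ((hint.integrableOn.indicator (hm _ hsi).compl).const_mul _)]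
      refine integral_congr_ae (ae_of_all _ fun ω => ?_)
      by_cases h : ω ∈ s i <;> simp [Finset.prod_insert hi, h]
      ring
    have hT : ∀ j ∈ T, MeasurableSet[m] (s j) := fun j hj => hs j (Finset.mem_insert_of_mem hj)
    have h1 := ih hT hA
    have h2 := ih hT (hA.inter hsi.compl)
    rw [key, key, show A ∩ B ∩ (s i)ᶜ = A ∩ (s i)ᶜ ∩ B from Set.inter_right_comm _ _ _]
    rw [abs_le] at h1 h2 ⊢
    obtain ⟨hc0, hc1⟩ := hc
    constructor <;> nlinarith

/-- Summing over the residue classes modulo `m` counts the first `m * L` indices. -/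
theorem sum_residues_le_ballCount {Ω E : Type*} [SeminormedAddCommGroup E]
    {X : TriangularArray Ω E} {x : E} {n : ℕ} {t : ℝ} {m L : ℕ} (hL : m * L ≤ n) (ω : Ω) :
    ∑ a ∈ Finset.range m, ∑ j ∈ Finset.range L,
        (ballEvent X x n t (m * j + a)).indicator (fun _ => (1 : ℝ)) ω ≤
      ballCount X x n t ω := by
  have hsum : ∀ (f : ℕ → ℝ) (l : ℕ), ∑ i ∈ Finset.range (m * l), f i =
      ∑ j ∈ Finset.range l, ∑ a ∈ Finset.range m, f (m * j + a) := by
    intro f l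
    induction l with
    | zero => simp
    | succ l ih => rw [Nat.mul_succ, Finset.sum_range_add, ih, Finset.sum_range_succ]
  rw [Finset.sum_comm, ← hsum fun i => (ballEvent X x n t i).indicator (fun _ => (1 : ℝ)) ω,
    ballCount_eq_sum]
  exact Finset.sum_le_sum_of_subset_of_nonneg (Finset.range_mono hL)
    fun i _ _ => Set.indicator_nonneg (fun _ _ => zero_le_one) ω

variable {Ω E : Type*} [MeasurableSpace Ω] [MeasurableSpace E] {P : Measure Ω}

theorem GeometricMixing.abs_sub_le [IsProbabilityMeasure P] {X : TriangularArray Ω E} {γ : ℝ}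
    (h : GeometricMixing P X γ) {n j m : ℕ} (hm : 1 ≤ m) (hj : 1 ≤ j) (hjm : j + m ≤ n)
    {A B : Set Ω} (hA : MeasurableSet[segmentSigma X n 1 j] A)
    (hB : MeasurableSet[segmentSigma X n (j + m) n] B) :
    |P.real (A ∩ B) - P.real A * P.real B| ≤ Real.exp (-γ * m) :=
  (le_csSup (mixingSet_bddAbove P X m) ⟨n, j, A, B, hj, hjm, hA, hB, rfl⟩).trans (h m hm)

variable [SeminormedAddCommGroup E] [OpensMeasurableSpace E] {X : TriangularArray Ω E} {x : E}
  {n : ℕ} {t γ : ℝ} {μ : Measure E}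

/-- Along an arithmetic progression of step `m` the expectation of the product of the functions
`1 - c 1_{X_i ∈ B(x, t)}` factorizes up to an error `exp (-γ m)` per factor. -/
theorem integral_prod_progression_le [IsProbabilityMeasure P] [IsProbabilityMeasure μ]
    (hX : HasMarginal P X μ)
    (hmix : GeometricMixing P X γ) {c : ℝ} (hc : c ∈ Set.Icc (0 : ℝ) 1) {m a : ℕ} (hm : 1 ≤ m)
    (ha : a < m) (L : ℕ) (hL : m * L ≤ n) :
    ∫ ω, ∏ j ∈ Finset.range L,
        (1 - c * (ballEvent X x n t (m * j + a)).indicator (fun _ => (1 : ℝ)) ω) ∂P ≤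
      (1 - c * μ.real (Metric.closedBall x t)) ^ L + L * Real.exp (-γ * m) := by
  set q := μ.real (Metric.closedBall x t) with hq
  have hq0 : 0 ≤ q := measureReal_nonneg
  have hq1 : q ≤ 1 := measureReal_le_one
  obtain ⟨hc0, hc1⟩ := id hc
  have hms : ∀ j : ℕ, MeasurableSet (ballEvent X x n t (m * j + a)) :=
    fun j => measurableSet_ballEvent hX _
  induction L with
  | zero => simp
  | succ L ih =>
    have hidx : m * L + a < n := by
      rw [Nat.mul_succ] at hL
      omega
    have hB := hms L
    set B := ballEvent X x n t (m * L + a) with hBdef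
    have hint := integrable_prod_one_sub_indicator (P := P) hc hms (Finset.range L)
    set F : Ω → ℝ := fun ω => ∏ j ∈ Finset.range L,
      (1 - c * (ballEvent X x n t (m * j + a)).indicator (fun _ => (1 : ℝ)) ω) with hF
    have hPB : P.real B = q := measureReal_ballEvent hX hidx
    -- the covariance of the product of the first `L` factors with the indicator of the last event
    have hcov : (∫ ω, F ω ∂P) * q - ∫ ω in B, F ω ∂P ≤ Real.exp (-γ * m) := by
      rcases Nat.eq_zero_or_pos L with rfl | hLpos
      · simp only [hF, Finset.range_zero, Finset.prod_empty, integral_const,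
          probReal_univ, smul_eq_mul, mul_one, one_mul, measureReal_restrict_apply_univ, hPB,
          sub_self]
        exact (Real.exp_pos _).le
      · obtain ⟨L', rfl⟩ : ∃ L', L = L' + 1 := ⟨L - 1, by omega⟩
        have hstep : m * L' + a + 1 + m = m * (L' + 1) + a + 1 := by ring
        have hle := abs_setIntegral_prod_sub_le (P := P) (B := B) (segmentSigma_le (n := n) hX 1
          (m * L' + a + 1)) (fun A hA => hmix.abs_sub_le (j := m * L' + a + 1) hm (by omega)
            (by omega) hA (measurableSet_segmentSigma_ballEvent hidx hstep.le (by omega)))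
          hc hms (Finset.range (L' + 1)) (fun j hj => by
            have hj' : m * j ≤ m * L' := Nat.mul_le_mul_left m
              (Nat.lt_succ_iff.1 (Finset.mem_range.1 hj))
            exact measurableSet_segmentSigma_ballEvent (by omega) (by omega) (by omega))
          (A := Set.univ) (@MeasurableSet.univ _ (_))
        rw [Set.univ_inter, setIntegral_univ, hPB] at hle
        have := (abs_le.1 hle).1
        linarith
    have hsplit : ∫ ω, ∏ j ∈ Finset.range (L + 1),
          (1 - c * (ballEvent X x n t (m * j + a)).indicator (fun _ => (1 : ℝ)) ω) ∂P =
        (∫ ω, F ω ∂P) - c * ∫ ω in B, F ω ∂P := by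
      rw [← integral_indicator hB, ← integral_const_mul,
        ← integral_sub hint ((hint.indicator hB).const_mul c)]
      refine integral_congr_ae (ae_of_all _ fun ω => ?_)
      by_cases h : ω ∈ B <;> simp [Finset.prod_range_succ, hF, h, ← hBdef]
      ring
    have ih' := ih ((Nat.mul_le_mul_left m L.le_succ).trans hL)
    have hexp := Real.exp_pos (-γ * m)
    have hcq : c * q ≤ 1 := mul_le_one₀ hc1 hq0 hq1
    have hcq0 : 0 ≤ c * q := mul_nonneg hc0 hq0
    rw [hsplit, pow_succ]
    push_cast
    have h1 : (∫ ω, F ω ∂P) - c * ∫ ω in B, F ω ∂P ≤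
        (1 - c * q) * (∫ ω, F ω ∂P) + Real.exp (-γ * m) := by
      nlinarith [mul_le_mul_of_nonneg_left hcov hc0, mul_nonneg (sub_nonneg.2 hc1) hexp.le]
    have h2 : (1 - c * q) * (∫ ω, F ω ∂P) ≤
        (1 - c * q) * ((1 - c * q) ^ L + L * Real.exp (-γ * m)) :=
      mul_le_mul_of_nonneg_left ih' (by linarith)
    have h3 : (1 - c * q) * (L * Real.exp (-γ * m)) ≤ L * Real.exp (-γ * m) :=
      mul_le_of_le_one_left (by positivity) (by linarith)
    nlinarith

/-- Exponential Chebyshev inequality for the lower tail of the counting variable. Convexity of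
`exp` replaces `exp (-θ N)` by the average over the residue classes modulo `m` of
`exp (-(θ m) N_a)`, where `N_a` counts the points with index in the class `a`; distinct indices of
a class are at distance at least `m`. -/
theorem measureReal_ballCount_lt_le [IsProbabilityMeasure P] [IsProbabilityMeasure μ]
    (hX : HasMarginal P X μ)
    (hmix : GeometricMixing P X γ) {θ : ℝ} (hθ : 0 < θ) {m k : ℕ} (hm : 1 ≤ m) (hmn : m ≤ n)
    (hθm : θ * m ≤ 1) (hθk : θ * k ≤ 1) :
    P.real {ω | ballCount X x n t ω < k} ≤
      Real.exp 1 * (Real.exp (-(θ * n * μ.real (Metric.closedBall x t) / 4)) +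
        n * Real.exp (-γ * m)) := by
  set q := μ.real (Metric.closedBall x t) with hq
  have hq0 : 0 ≤ q := measureReal_nonneg
  have hq1 : q ≤ 1 := measureReal_le_one
  have hm0 : (0 : ℝ) < m := by exact_mod_cast hm
  set L := n / m with hLdef
  have hL : m * L ≤ n := Nat.mul_div_le n m
  have hL' : (n : ℝ) ≤ 2 * (m * L) := by
    have h1 : n < m * L + m := Nat.lt_mul_div_succ n hm
    have h2 : m ≤ m * L := Nat.le_mul_of_pos_right m (Nat.div_pos hmn hm)
    exact_mod_cast (by omega : n ≤ 2 * (m * L))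
  set c := 1 - Real.exp (-(θ * m)) with hcdef
  have hη0 : 0 < θ * m := mul_pos hθ hm0
  have hc : c ∈ Set.Icc (0 : ℝ) 1 := by
    refine ⟨sub_nonneg.2 (Real.exp_le_one_iff.2 (by linarith)), ?_⟩
    have := Real.exp_pos (-(θ * m))
    linarith
  have hc2 : θ * m / 2 ≤ c := by
    have h1 : Real.exp (-(θ * m)) ≤ 1 / (1 + θ * m) := by
      rw [Real.exp_neg, ← one_div]
      exact one_div_le_one_div_of_le (by linarith) (by linarith [Real.add_one_le_exp (θ * m)])
    have h2 : 1 / (1 + θ * m) ≤ 1 - θ * m / 2 := by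
      rw [div_le_iff₀ (by linarith)]
      nlinarith
    linarith
  -- the pointwise convexity bound
  have hpt : ∀ ω, Real.exp (-(θ * ballCount X x n t ω)) ≤
      ∑ a ∈ Finset.range m, (1 / m : ℝ) * ∏ j ∈ Finset.range L,
        (1 - c * (ballEvent X x n t (m * j + a)).indicator (fun _ => (1 : ℝ)) ω) := by
    intro ω
    have hprod : ∀ a, ∏ j ∈ Finset.range L,
        (1 - c * (ballEvent X x n t (m * j + a)).indicator (fun _ => (1 : ℝ)) ω) =
        Real.exp (-(θ * m) * ∑ j ∈ Finset.range L,
          (ballEvent X x n t (m * j + a)).indicator (fun _ => (1 : ℝ)) ω) := by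
      intro a
      rw [Finset.mul_sum, Real.exp_sum]
      refine Finset.prod_congr rfl fun j _ => ?_
      by_cases h : ω ∈ ballEvent X x n t (m * j + a) <;> simp [h, hcdef]
    simp only [hprod]
    refine le_trans ?_ (convexOn_exp.map_sum_le (t := Finset.range m) (w := fun _ => (1 / m : ℝ))
      (p := fun a => -(θ * m) * ∑ j ∈ Finset.range L,
          (ballEvent X x n t (m * j + a)).indicator (fun _ => (1 : ℝ)) ω)
      (fun _ _ => by positivity) (by simp [hm0.ne']) (fun _ _ => Set.mem_univ _))
    refine Real.exp_le_exp.2 ?_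
    have hsum := sum_residues_le_ballCount (X := X) (x := x) (t := t) hL ω
    simp only [smul_eq_mul]
    rw [← Finset.mul_sum, ← Finset.mul_sum]
    have hcancel : (1 / m : ℝ) * (-(θ * m) * ∑ a ∈ Finset.range m, ∑ j ∈ Finset.range L,
        (ballEvent X x n t (m * j + a)).indicator (fun _ => (1 : ℝ)) ω) =
        -(θ * ∑ a ∈ Finset.range m, ∑ j ∈ Finset.range L,
        (ballEvent X x n t (m * j + a)).indicator (fun _ => (1 : ℝ)) ω) := by
      field_simp
    rw [hcancel]
    exact neg_le_neg (mul_le_mul_of_nonneg_left hsum hθ.le)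
  have hprodint : ∀ a, Integrable (fun ω => ∏ j ∈ Finset.range L,
      (1 - c * (ballEvent X x n t (m * j + a)).indicator (fun _ => (1 : ℝ)) ω)) P :=
    fun a => integrable_prod_one_sub_indicator hc (fun j => measurableSet_ballEvent hX _) _
  have hexpint : Integrable (fun ω => Real.exp (-(θ * ballCount X x n t ω))) P := by
    refine Integrable.of_bound
      (((measurable_ballCount hX).const_mul θ).neg.exp).aestronglyMeasurable 1
      (ae_of_all _ fun ω => ?_)
    rw [Real.norm_eq_abs, Real.abs_exp, Real.exp_le_one_iff]
    exact neg_nonpos.2 (by positivity)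
  have hlaplace : ∫ ω, Real.exp (-(θ * ballCount X x n t ω)) ∂P ≤
      (1 - c * q) ^ L + L * Real.exp (-γ * m) := by
    refine (integral_mono hexpint (integrable_finsetSum _ fun a _ => (hprodint a).const_mul _)
      hpt).trans ?_
    rw [integral_finsetSum _ fun a _ => (hprodint a).const_mul _]
    simp only [integral_const_mul]
    refine (Finset.sum_le_sum fun a ha => mul_le_mul_of_nonneg_left
      (integral_prod_progression_le hX hmix hc hm (Finset.mem_range.1 ha) L hL)
      (by positivity)).trans (le_of_eq ?_)
    rw [Finset.sum_const, Finset.card_range, nsmul_eq_mul, ← mul_assoc,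
      mul_one_div_cancel hm0.ne', one_mul]
  have hpow : (1 - c * q) ^ L ≤ Real.exp (-(θ * n * q / 4)) := by
    have h1 : 1 - c * q ≤ Real.exp (-(c * q)) := by linarith [Real.add_one_le_exp (-(c * q))]
    have h0 : 0 ≤ 1 - c * q := sub_nonneg.2 (mul_le_one₀ hc.2 hq0 hq1)
    refine (pow_le_pow_left₀ h0 h1 L).trans ?_
    rw [← Real.exp_nat_mul]
    refine Real.exp_le_exp.2 ?_
    have h2 : θ * m / 2 * q * L ≤ c * q * L := by gcongr
    have h3 : θ * q * n ≤ θ * q * (2 * (m * L)) :=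
      mul_le_mul_of_nonneg_left hL' (by positivity)
    nlinarith
  have hLn : (L : ℝ) * Real.exp (-γ * m) ≤ n * Real.exp (-γ * m) := by
    gcongr
    exact Nat.div_le_self n m
  have hmarkov := mul_meas_ge_le_integral_of_nonneg (μ := P)
    (f := fun ω => Real.exp (-(θ * ballCount X x n t ω)))
    (ae_of_all _ fun ω => (Real.exp_pos _).le) hexpint (Real.exp (-1))
  have hsub : P.real {ω | ballCount X x n t ω < k} ≤
      P.real {ω | Real.exp (-1) ≤ Real.exp (-(θ * ballCount X x n t ω))} := by
    refine measureReal_mono fun ω hω => Real.exp_le_exp.2 (neg_le_neg ?_)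
    have hω' : (ballCount X x n t ω : ℝ) ≤ k := Nat.cast_le.2 (le_of_lt hω)
    exact (mul_le_mul_of_nonneg_left hω' hθ.le).trans hθk
  rw [Real.exp_neg, inv_mul_le_iff₀ (Real.exp_pos 1)] at hmarkov
  rw [Real.exp_neg] at hsub
  refine hsub.trans (hmarkov.trans (mul_le_mul_of_nonneg_left ?_ (Real.exp_pos 1).le))
  linarith

end KNN

/-! ### Moments from tails, the support of the marginal, and the lower bound -/

namespace KNN

theorem exp_neg_le_rpow {b y : ℝ} (hb : 0 < b) (hy : 0 < y) : Real.exp (-y) ≤ (b / y) ^ b := by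
  have h1 : y / b ≤ Real.exp (y / b) := by linarith [Real.add_one_le_exp (y / b)]
  have h2 : (y / b) ^ b ≤ Real.exp y := by
    refine (Real.rpow_le_rpow (by positivity) h1 hb.le).trans (le_of_eq ?_)
    rw [← Real.exp_mul, div_mul_cancel₀ _ hb.ne']
  rw [Real.exp_neg, ← inv_div, Real.inv_rpow (by positivity)]
  exact inv_anti₀ (by positivity) h2

/-- A tail of order `(a / t) ^ 2` at scale `a` forces an expectation of order `a`. -/
theorem integral_le_of_tail_le {Ω : Type*} [MeasurableSpace Ω] {P : Measure Ω}
    [IsProbabilityMeasure P] {Z : Ω → ℝ} (hZ : Integrable Z P) (hZ0 : 0 ≤ᵐ[P] Z) {a C : ℝ}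
    (ha : 0 < a) (htail : ∀ t, 0 < t → P.real {ω | t < Z ω} ≤ C * (a / t) ^ 2) :
    ∫ ω, Z ω ∂P ≤ (1 + C) * a := by
  rw [hZ.integral_eq_integral_meas_lt hZ0]
  set g : ℝ → ℝ := fun t => P.real {ω | t < Z ω} with hg
  have hanti : Antitone g := fun t t' htt' =>
    measureReal_mono fun ω hω => lt_of_le_of_lt htt' hω
  have hpow : IntegrableOn (fun t : ℝ => C * a ^ 2 * t ^ (-2 : ℝ)) (Set.Ioi a) :=
    (integrableOn_Ioi_rpow_of_lt (by norm_num) ha).const_mul _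
  have hle : ∀ t ∈ Set.Ioi a, g t ≤ C * a ^ 2 * t ^ (-2 : ℝ) := by
    intro t ht
    have ht0 : 0 < t := ha.trans ht
    refine (htail t ht0).trans (le_of_eq ?_)
    rw [Real.rpow_neg ht0.le, Real.rpow_two]
    field_simp
  have hIoi : IntegrableOn g (Set.Ioi a) := by
    refine Integrable.mono' hpow hanti.measurable.aestronglyMeasurable ?_
    refine (ae_restrict_iff' measurableSet_Ioi).2 (ae_of_all _ fun t ht => ?_)
    rw [Real.norm_eq_abs, abs_of_nonneg measureReal_nonneg]
    exact hle t ht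
  have hIoc : IntegrableOn g (Set.Ioc 0 a) := by
    refine Integrable.of_bound hanti.measurable.aestronglyMeasurable 1 (ae_of_all _ fun t => ?_)
    rw [Real.norm_eq_abs, abs_of_nonneg measureReal_nonneg]
    exact measureReal_le_one
  rw [← Set.Ioc_union_Ioi_eq_Ioi ha.le, setIntegral_union Set.Ioc_disjoint_Ioi_same
    measurableSet_Ioi hIoc hIoi]
  have h1 : ∫ t in Set.Ioc 0 a, g t ≤ a := by
    refine (setIntegral_mono_on hIoc (integrableOn_const (C := (1 : ℝ)) (by simp))
      measurableSet_Ioc fun t _ => measureReal_le_one).trans (le_of_eq ?_)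
    simp [ha.le]
  have h2 : ∫ t in Set.Ioi a, g t ≤ C * a := by
    refine (setIntegral_mono_on hIoi hpow measurableSet_Ioi hle).trans (le_of_eq ?_)
    rw [integral_const_mul, integral_Ioi_rpow_of_lt (by norm_num) ha,
      show (-2 + 1 : ℝ) = -1 by norm_num, Real.rpow_neg_one]
    field_simp
  linarith

section Support

variable {E : Type*} [PseudoMetricSpace E] [MeasurableSpace E] {μ : Measure E} {x : E}

theorem LocalLowerMass.mem_support {c r₀ s : ℝ} (h : LocalLowerMass μ x c r₀ s) (hc : 0 < c)
    (hr₀ : 0 < r₀) : x ∈ μ.support := by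
  refine (Measure.mem_support_iff_forall x).2 fun U hU => ?_
  obtain ⟨ε, hε, hsub⟩ := Metric.nhds_basis_closedBall.mem_iff.1 hU
  have hr : 0 < min ε r₀ := lt_min hε hr₀
  have hpos : 0 < μ.real (Metric.closedBall x (min ε r₀)) :=
    lt_of_lt_of_le (mul_pos hc (Real.rpow_pos_of_pos hr s)) (h _ hr (min_le_right _ _))
  exact (ENNReal.toReal_pos_iff.1 hpos).1.trans_le
    (measure_mono ((Metric.closedBall_subset_closedBall (min_le_left _ _)).trans hsub))

end Support

section Radius

variable {Ω E : Type*} [MeasurableSpace Ω] [SeminormedAddCommGroup E] [MeasurableSpace E]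
  {P : Measure Ω} {X : TriangularArray Ω E} {μ : Measure E} {x : E} {n k : ℕ}

/-- Almost surely the radius is at most the diameter of the support, since `x` and all points of
the row lie in it. -/
theorem ae_nnRadius_le [OpensMeasurableSpace E] [HereditarilyLindelofSpace E]
    (hX : HasMarginal P X μ) (hx : x ∈ μ.support)
    {D : ℝ} (hD : SupportInCompact μ D) (h : 1 ≤ k ∧ k ≤ n) :
    ∀ᵐ ω ∂P, nnRadius X x n k ω ≤ D := by
  obtain ⟨K, hK, hdiam, hsub⟩ := hD
  have hmem : ∀ i : Fin n, ∀ᵐ ω ∂P, X n i ω ∈ μ.support := by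
    intro i
    have hsupp : ∀ᵐ y ∂(P.map (X n i)), y ∈ μ.support := by
      rw [(hX n i).2]
      exact Measure.support_mem_ae
    exact ae_of_ae_map (hX n i).1.aemeasurable hsupp
  filter_upwards [ae_all_iff.2 hmem] with ω hω
  simp only [nnRadius, nearestNeighbor, h, and_self, dif_pos]
  rw [← dist_eq_norm]
  exact (Metric.dist_le_diam_of_mem hK.isBounded (hsub (hω _)) (hsub hx)).trans hdiam

theorem integrable_nnRadius_rpow [OpensMeasurableSpace E] [HereditarilyLindelofSpace E]
    [IsFiniteMeasure P] (hX : HasMarginal P X μ) (hx : x ∈ μ.support)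
    {D : ℝ} (hD : SupportInCompact μ D) (h : 1 ≤ k ∧ k ≤ n) {p : ℝ} (hp : 0 < p) :
    Integrable (fun ω => nnRadius X x n k ω ^ p) P := by
  refine Integrable.of_bound ((measurable_nnRadius hX h).pow_const p).aestronglyMeasurable
    (D ^ p) ?_
  filter_upwards [ae_nnRadius_le hX hx hD h] with ω hω
  rw [Real.norm_eq_abs, abs_of_nonneg (Real.rpow_nonneg (nnRadius_nonneg ω) p)]
  exact Real.rpow_le_rpow (nnRadius_nonneg ω) hω hp.le

variable [OpensMeasurableSpace E]

/-- The lower moment bound. At the radius `r = (δ k / n) ^ (1 / s)` the ball holds at most `k / 2`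
points on average; no mixing is involved. -/
theorem le_integral_nnRadius_rpow [IsProbabilityMeasure P]
    {p s cUp r₁ κ δ : ℝ} (hp : 0 < p) (hs : 0 < s) (hr₁ : 0 < r₁)
    (hX : HasMarginal P X μ) (hup : LocalUpperMass μ x cUp r₁ s) (h : 1 ≤ k ∧ k ≤ n)
    (hkn : (k : ℝ) ≤ κ * n) (hδ : 0 < δ) (hδ1 : cUp * δ ≤ 1 / 2) (hδ2 : δ * κ ≤ r₁ ^ s)
    (hint : Integrable (fun ω => nnRadius X x n k ω ^ p) P) :
    δ ^ (p / s) / 2 * ((k : ℝ) / n) ^ (p / s) ≤ ∫ ω, nnRadius X x n k ω ^ p ∂P := by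
  have hk : (0 : ℝ) < k := by exact_mod_cast h.1
  have hn : (0 : ℝ) < n := by exact_mod_cast h.1.trans h.2
  have hu : 0 < (k : ℝ) / n := div_pos hk hn
  set u := (k : ℝ) / n with hudef
  set r := (δ * u) ^ (1 / s) with hrdef
  have hr : 0 < r := by positivity
  have hrs : r ^ s = δ * u := by
    rw [hrdef, ← Real.rpow_mul (by positivity), one_div_mul_cancel hs.ne', Real.rpow_one]
  have hrp : r ^ p = δ ^ (p / s) * u ^ (p / s) := by
    rw [hrdef, ← Real.rpow_mul (by positivity), one_div_mul_eq_div,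
      Real.mul_rpow hδ.le hu.le]
  have hrr : r ≤ r₁ := by
    refine (Real.rpow_le_rpow_iff hr.le hr₁.le hs).1 ?_
    rw [hrs]
    have : u ≤ κ := (div_le_iff₀ hn).2 hkn
    exact (mul_le_mul_of_nonneg_left this hδ.le).trans hδ2
  have hmean : n * μ.real (Metric.closedBall x r) ≤ k / 2 := by
    have h1 := hup r hr hrr
    rw [hrs] at h1
    have h2 : cUp * (δ * u) ≤ 1 / 2 * u := by
      rw [← mul_assoc]
      exact mul_le_mul_of_nonneg_right hδ1 hu.le
    have h3 := mul_le_mul_of_nonneg_left (h1.trans h2) hn.le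
    refine h3.trans (le_of_eq ?_)
    rw [hudef]
    field_simp
  have hhalf := half_le_measureReal_lt_nnRadius hX h hmean
  have hmarkov := mul_meas_ge_le_integral_of_nonneg (μ := P)
    (ae_of_all _ fun ω => Real.rpow_nonneg (nnRadius_nonneg (X := X) ω) p) hint (r ^ p)
  have hmono : P.real {ω | r < nnRadius X x n k ω} ≤
      P.real {ω | r ^ p ≤ nnRadius X x n k ω ^ p} :=
    measureReal_mono fun ω hω => Real.rpow_le_rpow hr.le (le_of_lt hω) hp.le
  have hfin := mul_le_mul_of_nonneg_left (hhalf.trans hmono) (Real.rpow_nonneg hr.le p)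
  rw [hrp] at hfin hmarkov
  linarith

end Radius

end KNN

/-! ### The upper bound -/

namespace KNN

/-- The tail of the radius, at every radius `t ≤ r₀` and for every prescribed order `b`. With
`m ≥ (1 + b) / γ * log n` the mixing error `n exp (-γ m)` is at most `n ^ (-b)`, while
`m ≤ M k` with `M = (1 + b) / (γ K₀) + 1` because `k ≥ K₀ log n`; so `θ = 1 / (M k)` is
admissible in `measureReal_ballCount_lt_le`. -/
theorem measureReal_lt_nnRadius_le {Ω E : Type*} [MeasurableSpace Ω] [SeminormedAddCommGroup E]
    [MeasurableSpace E] [OpensMeasurableSpace E] {P : Measure Ω} [IsProbabilityMeasure P]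
    {X : TriangularArray Ω E} {μ : Measure E} [IsProbabilityMeasure μ] {x : E} {n k : ℕ}
    {b s γ cLow r₀ K₀ t : ℝ} (hb : 0 < b) (hs : 0 < s)
    (hγ : 0 < γ) (hcLow : 0 < cLow) (hK₀ : 0 < K₀) (hX : HasMarginal P X μ)
    (hmix : GeometricMixing P X γ) (hlow : LocalLowerMass μ x cLow r₀ s)
    (hn : 2 ≤ n) (hlog : (1 + b) / γ * Real.log n + 1 ≤ n) (h : 1 ≤ k ∧ k ≤ n)
    (hk : K₀ * Real.log n ≤ k) (ht : 0 < t) (htr : t ≤ r₀) :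
    P.real {ω | t < nnRadius X x n k ω} ≤
      Real.exp 1 * ((4 * ((1 + b) / (γ * K₀) + 1) * b / cLow) ^ b + (r₀ ^ s) ^ b) *
        ((k : ℝ) / n / t ^ s) ^ b := by
  have hk1 : (1 : ℝ) ≤ k := by exact_mod_cast h.1
  have hk0 : (0 : ℝ) < k := by linarith
  have hn2 : (2 : ℝ) ≤ n := by exact_mod_cast hn
  have hn0 : (0 : ℝ) < n := by linarith
  have hlogpos : 0 < Real.log n := Real.log_pos (by linarith)
  have hts : 0 < t ^ s := Real.rpow_pos_of_pos ht s
  set A := (1 + b) / γ with hA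
  have hA0 : 0 < A := by positivity
  set M := (1 + b) / (γ * K₀) + 1 with hM
  have hM1 : 1 ≤ M := by
    have : 0 ≤ (1 + b) / (γ * K₀) := by positivity
    linarith
  have hM0 : 0 < M := by linarith
  set m := ⌈A * Real.log n⌉₊ with hm
  have hm1 : 1 ≤ m := Nat.one_le_ceil_iff.2 (by positivity)
  have hm_lt : (m : ℝ) < A * Real.log n + 1 := Nat.ceil_lt_add_one (by positivity)
  have hm_ge : A * Real.log n ≤ m := Nat.le_ceil _
  have hmn : m ≤ n := by exact_mod_cast (hm_lt.trans_le hlog).le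
  have hmM : (m : ℝ) ≤ M * k := by
    have h1 : A * Real.log n = (1 + b) / (γ * K₀) * (K₀ * Real.log n) := by
      rw [hA]
      field_simp
    have h2 : (1 + b) / (γ * K₀) * (K₀ * Real.log n) ≤ (1 + b) / (γ * K₀) * k :=
      mul_le_mul_of_nonneg_left hk (by positivity)
    rw [hM, add_mul, one_mul]
    linarith
  have hkM : (k : ℝ) ≤ M * k := le_mul_of_one_le_left hk0.le hM1
  have hMk : 0 < M * k := by positivity
  have hset : {ω | t < nnRadius X x n k ω} = {ω | ballCount X x n t ω < k} := by
    ext ω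
    exact lt_nnRadius_iff h ω
  have hmain := measureReal_ballCount_lt_le (x := x) (t := t) (k := k) hX hmix
    (θ := 1 / (M * k)) (by positivity) hm1 hmn
    (by rw [one_div_mul_eq_div]; exact (div_le_one hMk).2 hmM)
    (by rw [one_div_mul_eq_div]; exact (div_le_one hMk).2 hkM)
  rw [hset]
  refine hmain.trans ?_
  rw [mul_assoc (Real.exp 1)]
  refine mul_le_mul_of_nonneg_left ?_ (Real.exp_pos 1).le
  rw [add_mul ((4 * M * b / cLow) ^ b)]
  refine add_le_add ?_ ?_
  · set y := cLow * t ^ s * n / (4 * (M * k)) with hy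
    have hy0 : 0 < y := by positivity
    have hyq : y ≤ 1 / (M * k) * n * μ.real (Metric.closedBall x t) / 4 := by
      have h1 := hlow t ht htr
      have h2 : y = 1 / (M * k) * n * (cLow * t ^ s) / 4 := by
        rw [hy]
        field_simp
      rw [h2]
      gcongr
    refine (Real.exp_le_exp.2 (neg_le_neg hyq)).trans ((exp_neg_le_rpow hb hy0).trans
      (le_of_eq ?_))
    rw [← Real.mul_rpow (by positivity) (by positivity)]
    congr 1
    rw [hy]
    field_simp
  · have h1 : n * Real.exp (-γ * m) ≤ (1 / (n : ℝ)) ^ b := by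
      have h2 : Real.exp (-γ * m) ≤ Real.exp (-(1 + b) * Real.log n) := by
        refine Real.exp_le_exp.2 ?_
        have h3 : γ * (A * Real.log n) = (1 + b) * Real.log n := by
          rw [hA]
          field_simp
        have h4 := mul_le_mul_of_nonneg_left hm_ge hγ.le
        linarith
      refine (mul_le_mul_of_nonneg_left h2 hn0.le).trans (le_of_eq ?_)
      rw [mul_comm (-(1 + b)), ← Real.rpow_def_of_pos hn0, neg_add, Real.rpow_add hn0,
        Real.rpow_neg_one, mul_inv_cancel_left₀ hn0.ne', one_div, Real.inv_rpow hn0.le,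
        Real.rpow_neg hn0.le]
    refine h1.trans ?_
    have hr₀ : 0 < r₀ := ht.trans_le htr
    rw [← Real.mul_rpow (by positivity) (by positivity)]
    refine Real.rpow_le_rpow (by positivity) ?_ hb.le
    have h5 : t ^ s ≤ r₀ ^ s := Real.rpow_le_rpow ht.le htr hs.le
    rw [← mul_div_assoc, le_div_iff₀ hts, one_div_mul_eq_div, ← mul_div_assoc]
    refine div_le_div_of_nonneg_right ?_ hn0.le
    nlinarith

/-- The upper moment bound. The tail at radii `t ≤ r₀` extends to all `t`, at the cost of a
constant, because the radius is bounded by `D` almost surely; its order `2 p` exceeds `p`, so it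
integrates to a moment bound. -/
theorem integral_nnRadius_rpow_le {Ω E : Type*} [MeasurableSpace Ω] [SeminormedAddCommGroup E]
    [MeasurableSpace E] {P : Measure Ω} [IsProbabilityMeasure P]
    {X : TriangularArray Ω E} {x : E} {n k : ℕ} {p s r₀ D C : ℝ}
    (hp : 0 < p) (hs : 0 < s) (hr₀ : 0 < r₀) (hD : r₀ ≤ D) (hC : 0 ≤ C) (h : 1 ≤ k ∧ k ≤ n)
    (hbound : ∀ᵐ ω ∂P, nnRadius X x n k ω ≤ D)
    (htail : ∀ t, 0 < t → t ≤ r₀ →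
      P.real {ω | t < nnRadius X x n k ω} ≤ C * ((k : ℝ) / n / t ^ s) ^ (2 * p / s))
    (hint : Integrable (fun ω => nnRadius X x n k ω ^ p) P) :
    ∫ ω, nnRadius X x n k ω ^ p ∂P ≤
      (1 + C * (D / r₀) ^ (2 * p)) * ((k : ℝ) / n) ^ (p / s) := by
  have hk0 : (0 : ℝ) < k := by exact_mod_cast h.1
  have hn0 : (0 : ℝ) < n := by exact_mod_cast h.1.trans h.2
  set u := (k : ℝ) / n with hu
  have hu0 : 0 < u := by positivity
  have hpow : ∀ τ : ℝ, 0 < τ → (u / τ ^ s) ^ (2 * p / s) = u ^ (2 * p / s) / τ ^ (2 * p) := by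
    intro τ hτ
    rw [Real.div_rpow hu0.le (by positivity), ← Real.rpow_mul hτ.le, mul_div_cancel₀ _ hs.ne']
  have hD0 : 0 < D := hr₀.trans_le hD
  have hratio : 1 ≤ (D / r₀) ^ (2 * p) :=
    Real.one_le_rpow ((one_le_div hr₀).2 hD) (by positivity)
  have hall : ∀ τ, 0 < τ → P.real {ω | τ < nnRadius X x n k ω} ≤
      C * (D / r₀) ^ (2 * p) * (u ^ (2 * p / s) / τ ^ (2 * p)) := by
    intro τ hτ
    rcases le_or_gt τ r₀ with h1 | h1
    · refine (htail τ hτ h1).trans ?_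
      rw [hpow τ hτ]
      exact mul_le_mul_of_nonneg_right (le_mul_of_one_le_right hC hratio) (by positivity)
    rcases le_or_gt τ D with h2 | h2
    · have hmono : P.real {ω | τ < nnRadius X x n k ω} ≤ P.real {ω | r₀ < nnRadius X x n k ω} :=
        measureReal_mono fun ω hω => h1.trans hω
      refine (hmono.trans (htail r₀ hr₀ le_rfl)).trans ?_
      rw [hpow r₀ hr₀, mul_assoc]
      refine mul_le_mul_of_nonneg_left ?_ hC
      have h3 : τ ^ (2 * p) ≤ D ^ (2 * p) := Real.rpow_le_rpow hτ.le h2 (by positivity)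
      rw [Real.div_rpow hD0.le hr₀.le]
      calc u ^ (2 * p / s) / r₀ ^ (2 * p)
          = D ^ (2 * p) / r₀ ^ (2 * p) * (u ^ (2 * p / s) / D ^ (2 * p)) := by
            field_simp
        _ ≤ D ^ (2 * p) / r₀ ^ (2 * p) * (u ^ (2 * p / s) / τ ^ (2 * p)) := by gcongr
    · have hzero : P.real {ω | τ < nnRadius X x n k ω} = 0 := by
        rw [measureReal_eq_zero_iff]
        refine measure_mono_null (fun ω hω => ?_) (ae_iff.1 hbound)
        exact not_le.2 (h2.trans hω)
      rw [hzero]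
      positivity
  refine integral_le_of_tail_le hint (ae_of_all _ fun ω => Real.rpow_nonneg (nnRadius_nonneg ω) p)
    (by positivity) fun t ht => ?_
  have hset : {ω | t < nnRadius X x n k ω ^ p} = {ω | t ^ (1 / p) < nnRadius X x n k ω} := by
    ext ω
    rw [one_div]
    exact (Real.rpow_inv_lt_iff_of_pos ht.le (nnRadius_nonneg ω) hp).symm
  rw [hset]
  refine (hall _ (by positivity)).trans (le_of_eq ?_)
  congr 1
  rw [div_pow, ← Real.rpow_mul ht.le, ← Real.rpow_two (u ^ (p / s)), ← Real.rpow_mul hu0.le,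
    show 1 / p * (2 * p) = 2 by field_simp, Real.rpow_two]
  congr 2
  ring

end KNN

/-! ### Choice of the constants -/

theorem theorem5 (p s γ cLow cUp r₀ r₁ D K₀ κ : ℝ) (hp : 0 < p) (hs : 0 < s) (hγ : 0 < γ)
    (hcLow : 0 < cLow) (hcUp : 0 < cUp) (hr₀ : 0 < r₀) (hr₁ : 0 < r₁) (hK₀ : 0 < K₀)
    (hκ : 0 < κ) (hκ' : κ < cLow * r₀ ^ s / 8) :
    ∃ c C : ℝ, 0 < c ∧ c ≤ C ∧ ∃ n₀ : ℕ,
      ∀ (d : ℕ) (Ω : Type*) [MeasurableSpace Ω] (P : Measure Ω) [IsProbabilityMeasure P]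
        (X : KNN.TriangularArray Ω (EuclideanSpace ℝ (Fin d)))
        (μ : Measure (EuclideanSpace ℝ (Fin d))) [IsProbabilityMeasure μ]
        (x : EuclideanSpace ℝ (Fin d)),
        KNN.HasMarginal P X μ →
        KNN.GeometricMixing P X γ →
        KNN.LocalLowerMass μ x cLow r₀ s →
        KNN.LocalUpperMass μ x cUp r₁ s →
        KNN.SupportInCompact μ D →
        ∀ n k : ℕ, n₀ ≤ n → K₀ * Real.log n ≤ k → (k : ℝ) ≤ κ * n →
          Integrable (fun ω => KNN.nnRadius X x n k ω ^ p) P ∧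
          c * ((k : ℝ) / n) ^ (p / s) ≤ ∫ ω, KNN.nnRadius X x n k ω ^ p ∂P ∧
          ∫ ω, KNN.nnRadius X x n k ω ^ p ∂P ≤ C * ((k : ℝ) / n) ^ (p / s) := by
  have hb : 0 < 2 * p / s := by positivity
  -- the spacing `m` used for the upper bound must not exceed `n`
  obtain ⟨N, hN⟩ : ∃ N : ℕ, ∀ n : ℕ, N ≤ n →
      (1 + 2 * p / s) / γ * Real.log n + 1 ≤ n := by
    have hlim : Filter.Tendsto (fun n : ℕ => (n : ℝ)) Filter.atTop Filter.atTop :=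
      tendsto_natCast_atTop_atTop
    have hA : 0 < (1 + 2 * p / s) / γ := by positivity
    have hlog := hlim.eventually (Real.isLittleO_log_id_atTop.bound
      (show 0 < 1 / (2 * ((1 + 2 * p / s) / γ)) by positivity))
    obtain ⟨N, hN⟩ := Filter.eventually_atTop.1 hlog
    refine ⟨max N 2, fun n hn => ?_⟩
    have h1 := hN n ((le_max_left _ _).trans hn)
    have h2 : (2 : ℝ) ≤ n := by exact_mod_cast (le_max_right _ _).trans hn
    rw [Real.norm_eq_abs, id, Real.norm_eq_abs, abs_of_nonneg (by linarith : (0 : ℝ) ≤ n)] at h1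
    have h3 := mul_le_mul_of_nonneg_left ((le_abs_self _).trans h1) hA.le
    have h4 : (1 + 2 * p / s) / γ * (1 / (2 * ((1 + 2 * p / s) / γ)) * n) = n / 2 := by
      field_simp
    linarith
  set δ := min (1 / (2 * cUp)) (r₁ ^ s / κ) with hδdef
  have hδ : 0 < δ := lt_min (by positivity) (by positivity)
  have hδ1 : cUp * δ ≤ 1 / 2 := by
    refine (mul_le_mul_of_nonneg_left (min_le_left _ _) hcUp.le).trans (le_of_eq ?_)
    field_simp
  have hδ2 : δ * κ ≤ r₁ ^ s := by
    refine (mul_le_mul_of_nonneg_right (min_le_right _ _) hκ.le).trans (le_of_eq ?_)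
    field_simp
  set C₁ := Real.exp 1 * ((4 * ((1 + 2 * p / s) / (γ * K₀) + 1) * (2 * p / s) / cLow) ^ (2 * p / s) +
    (r₀ ^ s) ^ (2 * p / s)) with hC₁def
  have hC₁ : 0 ≤ C₁ := by positivity
  set C₂ := 1 + C₁ * (max D r₀ / r₀) ^ (2 * p) with hC₂def
  refine ⟨δ ^ (p / s) / 2, max (δ ^ (p / s) / 2) C₂, by positivity, le_max_left _ _, max N 2, ?_⟩
  intro d Ω _ P _ X μ _ x hX hmix hlow hup hsupp n k hn hk hkn
  have hn2 : 2 ≤ n := (le_max_right _ _).trans hn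
  have hn2' : (2 : ℝ) ≤ n := by exact_mod_cast hn2
  have hk0 : (0 : ℝ) < k := (mul_pos hK₀ (Real.log_pos (by linarith))).trans_le hk
  have hkk : 1 ≤ k ∧ k ≤ n := by
    refine ⟨by exact_mod_cast hk0, ?_⟩
    -- the ball of radius `r₀` has mass at most one, so `κ < 1 / 8`
    have hmass : cLow * r₀ ^ s ≤ 1 := (hlow r₀ hr₀ le_rfl).trans measureReal_le_one
    have hκ1 : κ ≤ 1 := by linarith
    have : (k : ℝ) ≤ n := hkn.trans (mul_le_of_le_one_left (by linarith) hκ1)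
    exact_mod_cast this
  have hx := hlow.mem_support hcLow hr₀
  have hint := KNN.integrable_nnRadius_rpow hX hx hsupp hkk hp
  refine ⟨hint, KNN.le_integral_nnRadius_rpow hp hs hr₁ hX hup hkk hkn hδ hδ1 hδ2 hint, ?_⟩
  have hupper := KNN.integral_nnRadius_rpow_le hp hs hr₀ (le_max_right D r₀) hC₁ hkk
    ((KNN.ae_nnRadius_le hX hx hsupp hkk).mono fun ω hω => hω.trans (le_max_left _ _))
    (fun t ht htr => KNN.measureReal_lt_nnRadius_le hb hs hγ hcLow hK₀ hX hmix hlow hn2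
      (hN n ((le_max_left _ _).trans hn)) hkk hk ht htr) hint
  exact hupper.trans (mul_le_mul_of_nonneg_right (le_max_right _ _) (by positivity))
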